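/- Conventions. A groupoid $G$ is a small category in which every arrow is invertible; $G^{(0)}$ denotes its set of units, regarded as a subset of $G$, and $r,s\colon G\to G^{(0)}$ are the range and source maps; the product $\gamma\eta$ is defined when $s(\gamma)=r(\eta)$. A topological groupoid is a groupoid with a topology for which $r$, $s$, inversion and multiplication (on the subspace of composable pairs of $G\times G$) are continuous, $G^{(0)}$ having the subspace topology. It is called locally compact if $G$ is locally compact and $G^{(0)}$ is Hausdorff ($G$ itself is not assumed to be Hausdorff). For $x\in G^{(0)}$ put $G^x=r^{-1}(x)$ (the transversal at $x$) and $G^x_x=r^{-1}(x)\cap s^{-1}(x)$ (the isotropy group at $x$, which acts on $G^x$ by left multiplication). $G$ is locally trivial if for every $x\in G^{(0)}$ the restriction $s|_{G^x}\colon G^x\to G^{(0)}$ is a surjective local homeomorphism. A Radon measure is a positive Borel measure that is finite on compact sets, outer regular on Borel sets, and inner regular with respect to compact sets on open sets. Its support is the smallest closed set with null complement, and it is fully supported if its support is the whole space. A Haar system on $G$ is a family $(\alpha^u)_{u\in G^{(0)}}$ of Radon measures on $G$ such that the support of $\alpha^u$ is $G^u$ for every $u$; for every $f\in C_c(G)$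 the function $u\mapsto\int f\,d\alpha^u$ belongs to $C_c(G^{(0)})$; and for all $f\in C_c(G)$ and $\gamma\in G$, $$\int_{G^{s(\gamma)}} f(\gamma\eta)\,d\alpha^{s(\gamma)}(\eta)=\int_{G^{r(\gamma)}} f(\eta)\,d\alpha^{r(\gamma)}(\eta).$$ Theorem. Let $G$ be a locally compact, locally trivial groupoid and let $x\in G^{(0)}$. Consider the following statements: (1) $G$ has a Haar system; (2) the transversal $G^x$ carries a fully supported Radon measure that is invariant under the left multiplication action of $G^x_x$ on $G^x$; (3) $G^{(0)}$ carries a fully supported Radon measure. Then (1) $\iff$ (2) and (3) $\implies$ (2). If moreover $G^{(0)}$ is paracompact, then (2) $\implies$ (3). -/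

import Mathlib

open CategoryTheory MeasureTheory Topology

/-! Groupoids are Mathlib's `CategoryTheory.Groupoid X`, with `X` the set of units.
The set of all arrows is `Quiver.Total X`.  An arrow `γ : a ⟶ b` has source `s(γ) = a` and range
`r(γ) = b`, and the product `γη`, defined if `s(γ) = r(η)`, is the composite `η ≫ γ`. -/

namespace TopGpd

universe v u

/-- The product `γη` of two arrows with `s(γ) = r(η)`. -/
def mul {X : Type u} [Groupoid.{v} X] (γ η : Quiver.Total X) (h : γ.left = η.right) :
    Quiver.Total X :=
  ⟨η.left, γ.right, η.hom ≫ eqToHom h.symm ≫ γ.hom⟩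

/-- The inverse arrow `γ⁻¹`. -/
def inv {X : Type u} [Groupoid.{v} X] (γ : Quiver.Total X) : Quiver.Total X :=
  ⟨γ.right, γ.left, Groupoid.inv γ.hom⟩

/-- The unit arrow at `a`. -/
def unit {X : Type u} [Groupoid.{v} X] (a : X) : Quiver.Total X :=
  ⟨a, a, 𝟙 a⟩

/-- A topological groupoid: the set of arrows carries a topology for which range, source,
inversion and multiplication (on the subspace of composable pairs) are continuous, and the set of
units has the subspace topology coming from `a ↦ unit a`. -/
class IsTopologicalGroupoid (X : Type u) [Groupoid.{v} X] [TopologicalSpace X]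
    [TopologicalSpace (Quiver.Total X)] : Prop where
  isEmbedding_unit : IsEmbedding (unit : X → Quiver.Total X)
  continuous_source : Continuous (fun γ : Quiver.Total X => γ.left)
  continuous_range : Continuous (fun γ : Quiver.Total X => γ.right)
  continuous_inv : Continuous (inv : Quiver.Total X → Quiver.Total X)
  continuous_mul : Continuous
    (fun p : {p : Quiver.Total X × Quiver.Total X // p.1.left = p.2.right} =>
      mul p.1.1 p.1.2 p.2)

/-- The transversal `G^a = r⁻¹(a)`; as a type it carries the subspace topology. -/
def rangeFibre {X : Type u} [Groupoid.{v} X] (a : X) : Set (Quiver.Total X) :=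
  {γ | γ.right = a}

/-- Left multiplication `η ↦ gη` by an arrow `g` from `a` to `b`, as a map `G^a → G^b`.
For `a = b` these are the maps of the left action of the isotropy group `G_a^a` on `G^a`. -/
def leftMul {X : Type u} [Groupoid.{v} X] {a b : X} (g : a ⟶ b) (η : rangeFibre a) :
    rangeFibre b :=
  ⟨mul ⟨a, b, g⟩ η.1 (Eq.symm η.2), rfl⟩

/-- Locally compact groupoid: the topology on the arrows is locally compact and the space of units
is Hausdorff (the space of arrows is not assumed to be Hausdorff). -/
class IsLocallyCompactGroupoid (X : Type u) [Groupoid.{v} X] [TopologicalSpace X]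
    [TopologicalSpace (Quiver.Total X)] : Prop extends IsTopologicalGroupoid X where
  locallyCompact_arrows : LocallyCompactSpace (Quiver.Total X)
  t2_units : T2Space X

/-- Locally trivial groupoid: for every unit `a`, the restriction of the source map to `G^a` is a
surjective local homeomorphism onto the space of units. -/
def IsLocallyTrivial (X : Type u) [Groupoid.{v} X] [TopologicalSpace X]
    [TopologicalSpace (Quiver.Total X)] : Prop :=
  ∀ a : X, IsLocalHomeomorph (fun γ : rangeFibre a => γ.1.left) ∧
    Function.Surjective (fun γ : rangeFibre a => γ.1.left)

/-- `S` is the support of `μ`: the smallest closed set whose complement is `μ`-null. -/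
def HasSupport {Y : Type*} [TopologicalSpace Y] [MeasurableSpace Y] (μ : Measure Y)
    (S : Set Y) : Prop :=
  IsLeast {C : Set Y | IsClosed C ∧ μ Cᶜ = 0} S

/-- `μ` is a fully supported (positive) Radon measure on `Y`.  `Measure.Regular` is the class of
measures in the Riesz representation theorem: finite on compact sets, outer regular, and inner
regular with respect to compact sets on open sets. -/
structure IsFullRadon {Y : Type*} [TopologicalSpace Y] [MeasurableSpace Y]
    (μ : Measure Y) : Prop where
  regular : μ.Regular
  fullSupport : HasSupport μ Set.univ

/-- A continuous family of fully supported Radon measures along `π : Y → Z`: the Radon measure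
`μ z` on `Y` has support equal to the fibre `π⁻¹(z)`, and `z ↦ ∫ f dμ_z` is in `C_c(Z)` for every
`f ∈ C_c(Y)`. -/
structure IsFullContinuousFamily {Y Z : Type*} [TopologicalSpace Y] [TopologicalSpace Z]
    [MeasurableSpace Y] (π : Y → Z) (μ : Z → Measure Y) : Prop where
  regular : ∀ z, (μ z).Regular
  hasSupport : ∀ z, HasSupport (μ z) (π ⁻¹' {z})
  continuous_integral : ∀ f : Y → ℂ, Continuous f → HasCompactSupport f →
    Continuous (fun z => ∫ y, f y ∂(μ z))
  hasCompactSupport_integral : ∀ f : Y → ℂ, Continuous f → HasCompactSupport f →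
    HasCompactSupport (fun z => ∫ y, f y ∂(μ z))

/-- A Haar system: a continuous family `(α^u)` of fully supported measures along the range map
which is left invariant, `∫_{G^{s(g)}} f(gη) dα^{s(g)}(η) = ∫_{G^{r(g)}} f(η) dα^{r(g)}(η)` for all
`f ∈ C_c(G)` and all arrows `g`.  The measure `α^{s(g)}` is concentrated on the closed set
`G^{s(g)}`, on which `η ↦ gη` is defined; its restriction to that subspace is written as a
`comap`. -/
structure IsHaarSystem {X : Type u} [Groupoid.{v} X] [TopologicalSpace X]
    [TopologicalSpace (Quiver.Total X)] [MeasurableSpace (Quiver.Total X)]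
    (α : X → Measure (Quiver.Total X)) : Prop extends
    IsFullContinuousFamily (fun γ : Quiver.Total X => γ.right) α where
  leftInvariant : ∀ (a b : X) (g : a ⟶ b) (f : Quiver.Total X → ℂ), Continuous f →
    HasCompactSupport f →
    ∫ η : rangeFibre a, f (leftMul g η).1 ∂((α a).comap (Subtype.val)) = ∫ η, f η ∂(α b)

/-- A Borel measure on `G^a` is invariant under left multiplication by the isotropy group
`G_a^a`. -/
def IsIsotropyInvariant {X : Type u} [Groupoid.{v} X] [MeasurableSpace (Quiver.Total X)]
    (a : X) (lam : Measure (rangeFibre a)) : Prop :=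
  ∀ g : a ⟶ a, MeasurePreserving (leftMul g) lam lam

end TopGpd

/-!
Fix a unit `x`. The source map `s : G^x → X` is an open surjection whose fibres are the orbits of
the isotropy group `G_x^x`, which acts freely. Since `s` is a local homeomorphism, the action is
properly discontinuous, and `G^x` and the space of all arrows are Hausdorff although this is not assumed
(`t2Space_rangeFibre`, `t2Space_total`, `finite_setOf_leftMul_mem`). Continuity of a function on `X`
can be tested after composition with `s`, so local sections are needed only for Hausdorffness.

A Haar system restricts to an invariant measure on `G^x`
(`IsHaarSystem.exists_isIsotropyInvariant`). Conversely, for an invariant measure `lam` on `G^x`,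
the image of `lam` under `η ↦ γ⁻¹η` depends only on `s(γ)`; these images form a Haar system
(`exists_isHaarSystem`).

Measures are moved between `X` and `G^x` by the Riesz representation theorem, in the form of
`exists_isFullRadon_of_transfer`: a positive operator `C_c(Y) → C_c(Z)` that annihilates no nonzero
`f ≥ 0` turns a fully supported Radon measure on `Z` into one on `Y`. From `X` to `G^x` the
operator sums a function over the orbits of `G_x^x`, and the resulting measure is invariant. From
`G^x` to `X` it is `f ↦ w · (f ∘ s)` with a Bruhat function `w`, which a partition of unity on the
paracompact space `X` provides (`exists_bruhat_function`).
-/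

namespace TopGpd

/-! ### Radon measures -/

theorem hasSupport_univ_iff {Y : Type*} [TopologicalSpace Y] [MeasurableSpace Y]
    {μ : Measure Y} : HasSupport μ Set.univ ↔ μ.IsOpenPosMeasure := by
  constructor
  · intro h
    refine ⟨fun U hU hne h0 => ?_⟩
    have := h.2 (show Uᶜ ∈ _ from ⟨hU.isClosed_compl, by rwa [compl_compl]⟩)
    obtain ⟨y, hy⟩ := hne
    exact this (Set.mem_univ y) hy
  · intro h
    refine ⟨⟨isClosed_univ, by simp⟩, fun C hC y _ => ?_⟩
    by_contra hy
    exact hC.1.isOpen_compl.measure_ne_zero μ ⟨y, hy⟩ hC.2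

/-- The push-forward of a regular measure along a closed embedding is regular. Outer regularity
holds because an open subset of the image extends to an open set by adding the complement of the
image, which is a null set. -/
theorem regular_map_of_isClosedEmbedding {Y Z : Type*} [TopologicalSpace Y] [TopologicalSpace Z]
    [MeasurableSpace Y] [BorelSpace Y] [MeasurableSpace Z] [BorelSpace Z] {f : Y → Z}
    (hf : IsClosedEmbedding f) (μ : Measure Y) [μ.Regular] : (μ.map f).Regular := by
  have hm : Measurable f := hf.continuous.measurable
  have h1 : IsFiniteMeasureOnCompacts (μ.map f) := by
    refine ⟨fun K hK => ?_⟩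
    rw [hf.measurableEmbedding.map_apply]
    exact (hf.isCompact_preimage hK).measure_lt_top
  have h2 : (μ.map f).OuterRegular := by
    refine ⟨fun A hA r hr => ?_⟩
    rw [hf.measurableEmbedding.map_apply] at hr
    obtain ⟨U, hAU, hU, hUr⟩ := (f ⁻¹' A).exists_isOpen_lt_of_lt r hr
    obtain ⟨V, hV, rfl⟩ := hf.isInducing.isOpen_iff.1 hU
    refine ⟨V ∪ (Set.range f)ᶜ, ?_, hV.union hf.isClosed_range.isOpen_compl, ?_⟩
    · intro z hz
      by_cases h : z ∈ Set.range f
      · obtain ⟨y, rfl⟩ := h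
        exact Or.inl (hAU hz)
      · exact Or.inr h
    · rw [hf.measurableEmbedding.map_apply]
      refine lt_of_le_of_lt (measure_mono ?_) hUr
      rintro y (hy | hy)
      · exact hy
      · exact absurd (Set.mem_range_self y) hy
  exact { innerRegular := Measure.Regular.innerRegular.map hm.aemeasurable
            (fun U hU => hU.preimage hf.continuous) (fun K hK => hK.image hf.continuous)
            (fun U hU => hU.measurableSet) }

/-- The restriction of a regular measure to a closed subspace with null complement is regular. -/
theorem regular_comap_of_isClosedEmbedding {Y Z : Type*} [TopologicalSpace Y] [TopologicalSpace Z]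
    [MeasurableSpace Y] [BorelSpace Y] [MeasurableSpace Z] [BorelSpace Z] {f : Y → Z}
    (hf : IsClosedEmbedding f) (μ : Measure Z) [μ.Regular] (h0 : μ (Set.range f)ᶜ = 0) :
    (μ.comap f).Regular := by
  have hme := hf.measurableEmbedding
  have h1 := Measure.OuterRegular.comap' μ hf.continuous hme
  have h2 := IsFiniteMeasureOnCompacts.comap' μ hf.continuous hme
  refine { innerRegular := fun U hU r hr => ?_ }
  obtain ⟨V, hV, rfl⟩ := hf.isInducing.isOpen_iff.1 hU
  have hVr : r < μ V := by
    rw [hme.comap_apply] at hr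
    exact hr.trans_le (measure_mono (Set.image_preimage_subset f V))
  obtain ⟨K, hKV, hK, hrK⟩ := hV.exists_lt_isCompact hVr
  refine ⟨f ⁻¹' K, Set.preimage_mono hKV, hf.isCompact_preimage hK, hrK.trans_le ?_⟩
  rw [hme.comap_apply, Set.image_preimage_eq_inter_range]
  exact (measure_inter_conull h0).ge

/-- Transfer of fully supported Radon measures: let `T` be a positive linear operator
`C_c(Y) → C_c(Z)` such that `T f` is not identically zero if `f ≥ 0` is not.  If `Z` carries a fully
supported Radon measure `μ`, then the Riesz representation theorem, applied to `f ↦ ∫ T f dμ`,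
provides one on `Y`. -/
theorem exists_isFullRadon_of_transfer {Y Z : Type*} [TopologicalSpace Y] [T2Space Y]
    [LocallyCompactSpace Y] [MeasurableSpace Y] [BorelSpace Y] [TopologicalSpace Z]
    [MeasurableSpace Z] [BorelSpace Z] {μ : Measure Z} (hμ : IsFullRadon μ)
    (T : CompactlySupportedContinuousMap Y ℝ →ₗ[ℝ] CompactlySupportedContinuousMap Z ℝ)
    (hpos : ∀ f, (∀ y, 0 ≤ f y) → ∀ z, 0 ≤ T f z)
    (hstrict : ∀ f, (∀ y, 0 ≤ f y) → ∀ y, 0 < f y → ∃ z, 0 < T f z) :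
    ∃ ν : Measure Y, IsFullRadon ν ∧
      ∀ f : CompactlySupportedContinuousMap Y ℝ, ∫ y, f y ∂ν = ∫ z, T f z ∂μ := by
  have := hμ.regular
  have hop : μ.IsOpenPosMeasure := hasSupport_univ_iff.1 hμ.fullSupport
  have hint : ∀ f : CompactlySupportedContinuousMap Z ℝ, Integrable f μ := fun f =>
    f.continuous.integrable_of_hasCompactSupport f.hasCompactSupport
  let Λ₀ : CompactlySupportedContinuousMap Y ℝ →ₗ[ℝ] ℝ :=
    { toFun := fun f => ∫ z, T f z ∂μ
      map_add' := fun f g => by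
        simp only [map_add, CompactlySupportedContinuousMap.coe_add, Pi.add_apply]
        exact integral_add (hint _) (hint _)
      map_smul' := fun c f => by
        simp only [map_smul, CompactlySupportedContinuousMap.coe_smul, Pi.smul_apply]
        exact integral_const_mul c _ }
  let Λ : CompactlySupportedContinuousMap Y ℝ →ₚ[ℝ] ℝ :=
    PositiveLinearMap.mk₀ Λ₀ fun f hf => integral_nonneg fun z => hpos f (fun y => hf y) z
  have hΛ : ∀ f, ∫ y, f y ∂(RealRMK.rieszMeasure Λ) = ∫ z, T f z ∂μ := fun f =>
    RealRMK.integral_rieszMeasure Λ f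
  refine ⟨RealRMK.rieszMeasure Λ, ⟨inferInstance, hasSupport_univ_iff.2 ⟨?_⟩⟩, hΛ⟩
  rintro U hU ⟨y, hy⟩ h0
  obtain ⟨f, hf1, hfc, hfU, hf01⟩ := exists_continuousMap_one_of_isCompact_subset_isOpen
    (isCompact_singleton (x := y)) hU (Set.singleton_subset_iff.2 hy)
  let F : CompactlySupportedContinuousMap Y ℝ := ⟨f, hfc⟩
  have hF0 : ∀ y, 0 ≤ F y := fun y => (hf01 y).1
  obtain ⟨z, hz⟩ := hstrict F hF0 y (by
    have : f y = 1 := hf1 rfl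
    change 0 < f y
    rw [this]; exact one_pos)
  have h1 : 0 < ∫ z, T F z ∂μ :=
    (T F).continuous.integral_pos_of_hasCompactSupport_nonneg_nonzero (T F).hasCompactSupport
      (hpos F hF0) hz.ne'
  have h2 : ∫ y, F y ∂(RealRMK.rieszMeasure Λ) = 0 := by
    refine integral_eq_zero_of_ae ?_
    filter_upwards [compl_mem_ae_iff.2 h0] with z hz
    exact image_eq_zero_of_notMem_tsupport fun h => hz (hfU h)
  rw [hΛ] at h2
  exact h1.ne' h2

/-! ### Left multiplication on the transversals -/

section Algebra

universe v u
variable {X : Type u} [Groupoid.{v} X]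

/-- An arrow `h` with range `a`, as an element of the transversal `G^a`. -/
def ofHom {a c : X} (h : c ⟶ a) : rangeFibre a := ⟨⟨c, a, h⟩, rfl⟩

theorem exists_eq_ofHom {a : X} (η : rangeFibre a) : ∃ h : η.1.left ⟶ a, η = ofHom h := by
  obtain ⟨⟨c, b, h⟩, rfl⟩ := η
  exact ⟨h, rfl⟩

theorem ofHom_injective {a c : X} : Function.Injective (ofHom : (c ⟶ a) → rangeFibre a) := by
  intro h k e
  have := congrArg Subtype.val e
  simpa [ofHom] using this

@[simp]
theorem leftMul_ofHom {a b c : X} (g : a ⟶ b) (h : c ⟶ a) :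
    leftMul g (ofHom h) = ofHom (h ≫ g) := by
  refine Subtype.ext ?_
  -- The `eqToHom` in `mul` is here an identity by definition.
  change (⟨c, b, h ≫ 𝟙 a ≫ g⟩ : Quiver.Total X) = ⟨c, b, h ≫ g⟩
  rw [Category.id_comp]

theorem leftMul_comp {a b c : X} (g : a ⟶ b) (k : b ⟶ c) (η : rangeFibre a) :
    leftMul k (leftMul g η) = leftMul (g ≫ k) η := by
  obtain ⟨h, hη⟩ := exists_eq_ofHom η
  rw [hη]; simp

theorem leftMul_id {a : X} (η : rangeFibre a) : leftMul (𝟙 a) η = η := by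
  obtain ⟨h, hη⟩ := exists_eq_ofHom η
  rw [hη]; simp

theorem leftMul_injective_left {a b : X} {g k : a ⟶ b} {η : rangeFibre a}
    (e : leftMul g η = leftMul k η) : g = k := by
  obtain ⟨h, hη⟩ := exists_eq_ofHom η
  rw [hη, leftMul_ofHom, leftMul_ofHom] at e
  exact (cancel_epi h).1 (ofHom_injective e)

/-- The isotropy group acts transitively on the fibres of the source map on a transversal. -/
theorem exists_leftMul_eq {a : X} {η ζ : rangeFibre a} (e : η.1.left = ζ.1.left) :
    ∃ g : a ⟶ a, leftMul g η = ζ := by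
  obtain ⟨⟨c, b, h⟩, rfl⟩ := η
  obtain ⟨⟨c', b', k⟩, hb⟩ := ζ
  change b' = b at hb
  change c = c' at e
  subst hb e
  refine ⟨Groupoid.inv h ≫ k, ?_⟩
  change leftMul _ (ofHom h) = ofHom k
  simp

theorem mul_left_cancel {τ γ γ' : Quiver.Total X} (h : τ.left = γ.right) (h' : τ.left = γ'.right)
    (e : mul τ γ h = mul τ γ' h') : γ = γ' := by
  obtain ⟨a, b, t⟩ := τ
  obtain ⟨c, d, k⟩ := γ
  obtain ⟨c', d', k'⟩ := γ'
  change a = d at h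
  change a = d' at h'
  subst h h'
  have e' : ofHom (k ≫ t) = ofHom (k' ≫ t) := Subtype.ext (by simpa [mul, ofHom] using e)
  rw [← leftMul_ofHom, ← leftMul_ofHom] at e'
  have := congrArg (leftMul (Groupoid.inv t)) e'
  simp only [leftMul_comp, Groupoid.comp_inv, leftMul_id] at this
  exact congrArg Subtype.val this

/-- The arrow `γ⁻¹η`, for `γ` and `η` in the same transversal. -/
def leftDiv {a : X} (γ η : rangeFibre a) : Quiver.Total X :=
  mul (inv γ.1) η.1 (γ.2.trans η.2.symm)

theorem leftDiv_ofHom {a c : X} (h : c ⟶ a) (η : rangeFibre a) :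
    leftDiv (ofHom h) η = (leftMul (Groupoid.inv h) η).1 := rfl

theorem leftDiv_leftMul {a b : X} (g : a ⟶ b) (γ η : rangeFibre a) :
    leftDiv (leftMul g γ) (leftMul g η) = leftDiv γ η := by
  obtain ⟨h, hγ⟩ := exists_eq_ofHom γ
  rw [hγ, leftMul_ofHom, leftDiv_ofHom, leftDiv_ofHom, leftMul_comp]
  simp

end Algebra

/-! ### Topology of a locally trivial groupoid -/

section Topology

universe v u
variable {X : Type u} [Groupoid.{v} X] [TopologicalSpace X] [TopologicalSpace (Quiver.Total X)]

section
variable [IsTopologicalGroupoid X]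

theorem continuous_leftDiv (a : X) :
    Continuous (fun p : rangeFibre a × rangeFibre a => leftDiv p.1 p.2) :=
  (IsTopologicalGroupoid.continuous_mul (X := X)).comp
    (Continuous.subtype_mk (f := fun p : rangeFibre a × rangeFibre a => (inv p.1.1, p.2.1))
      (((IsTopologicalGroupoid.continuous_inv (X := X)).comp
        (continuous_subtype_val.comp continuous_fst)).prodMk
        (continuous_subtype_val.comp continuous_snd)) fun p => p.1.2.trans p.2.2.symm)

theorem continuous_leftMul {a b : X} (g : a ⟶ b) : Continuous (leftMul g) :=
  have h : Continuous (fun η : rangeFibre a => (⟨(⟨a, b, g⟩, η.1), Eq.symm η.2⟩ :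
      {p : Quiver.Total X × Quiver.Total X // p.1.left = p.2.right})) :=
    (continuous_const.prodMk continuous_subtype_val).subtype_mk _
  ((IsTopologicalGroupoid.continuous_mul (X := X)).comp h).subtype_mk _

/-- Left multiplication by an arrow is a homeomorphism between transversals. -/
def leftMulHomeo {a b : X} (g : a ⟶ b) : rangeFibre a ≃ₜ rangeFibre b where
  toFun := leftMul g
  invFun := leftMul (Groupoid.inv g)
  left_inv η := by simp [leftMul_comp, leftMul_id]
  right_inv η := by simp [leftMul_comp, leftMul_id]
  continuous_toFun := continuous_leftMul g
  continuous_invFun := continuous_leftMul _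

theorem continuous_source_rangeFibre (a : X) :
    Continuous (fun γ : rangeFibre a => γ.1.left) :=
  (IsTopologicalGroupoid.continuous_source (X := X)).comp continuous_subtype_val

theorem isClosed_rangeFibre [T2Space X] (a : X) : IsClosed (rangeFibre a) :=
  isClosed_eq (IsTopologicalGroupoid.continuous_range (X := X)) continuous_const

theorem isClosedEmbedding_leftDiv [T2Space X] {a : X} (γ : rangeFibre a) :
    IsClosedEmbedding (leftDiv γ) := by
  obtain ⟨h, hγ⟩ := exists_eq_ofHom γ
  rw [hγ]
  exact (isClosed_rangeFibre γ.1.left).isClosedEmbedding_subtypeVal.comp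
    (leftMulHomeo (Groupoid.inv h)).isClosedEmbedding

theorem range_leftDiv {a : X} (γ : rangeFibre a) :
    Set.range (leftDiv γ) = rangeFibre γ.1.left := by
  obtain ⟨h, hγ⟩ := exists_eq_ofHom γ
  have : leftDiv γ = Subtype.val ∘ leftMulHomeo (Groupoid.inv h) :=
    (congrArg leftDiv hγ).trans rfl
  rw [this, Set.range_comp, (leftMulHomeo _).surjective.range_eq, Set.image_univ,
    Subtype.range_coe]

/-- The set of products of two compact sets of arrows is compact, since the set of composable pairs
is closed. -/
theorem isCompact_setOf_mul [T2Space X] {K L : Set (Quiver.Total X)} (hK : IsCompact K)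
    (hL : IsCompact L) : IsCompact {γ | ∃ κ ∈ K, ∃ l ∈ L, ∃ h : κ.left = l.right,
      γ = mul κ l h} := by
  have hcl : IsClosed {p : Quiver.Total X × Quiver.Total X | p.1.left = p.2.right} :=
    isClosed_eq ((IsTopologicalGroupoid.continuous_source (X := X)).comp continuous_fst)
      ((IsTopologicalGroupoid.continuous_range (X := X)).comp continuous_snd)
  have := (hcl.isClosedEmbedding_subtypeVal.isCompact_preimage (hK.prod hL)).image
    (IsTopologicalGroupoid.continuous_mul (X := X))
  convert this using 1
  ext γ
  constructor
  · rintro ⟨κ, hκ, l, hl, h, rfl⟩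
    exact ⟨⟨(κ, l), h⟩, ⟨hκ, hl⟩, rfl⟩
  · rintro ⟨⟨⟨κ, l⟩, h⟩, ⟨hκ, hl⟩, rfl⟩
    exact ⟨κ, hκ, l, hl, h, rfl⟩

/-- The isotropy group acts freely and the source map is locally injective, so that two points of
the same orbit have disjoint neighbourhoods; points of different orbits are separated by the
source map. -/
theorem t2Space_rangeFibre [T2Space X] {a : X}
    (hs : IsLocalHomeomorph (fun γ : rangeFibre a => γ.1.left)) : T2Space (rangeFibre a) := by
  refine ⟨fun γ η hne => ?_⟩
  by_cases h : γ.1.left = η.1.left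
  · obtain ⟨g, rfl⟩ := exists_leftMul_eq h
    obtain ⟨e, hγ, he⟩ := hs γ
    refine ⟨e.source, leftMulHomeo g '' e.source, e.open_source,
      (leftMulHomeo g).isOpenMap _ e.open_source, hγ, ⟨γ, hγ, rfl⟩, ?_⟩
    rw [Set.disjoint_left]
    rintro _ hω ⟨ω, hω', rfl⟩
    -- Both `ω` and `gω` lie in the domain of the chart `e` and have the same source.
    have h1 : leftMul g ω = ω := e.injOn hω hω' (by rw [← he]; rfl)
    have h2 : g = 𝟙 a := leftMul_injective_left (h1.trans (leftMul_id ω).symm)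
    exact hne (by rw [h2, leftMul_id])
  · obtain ⟨U, V, hU, hV, hγ, hη, hd⟩ := t2_separation h
    exact ⟨_, _, hU.preimage (continuous_source_rangeFibre a),
      hV.preimage (continuous_source_rangeFibre a), hγ, hη, hd.preimage _⟩

/-- Arrows with range in the domain of a local section `τ` of the source map of a transversal are
determined by their range and the product `τ(r(γ))γ`, which belongs to a Hausdorff space. -/
theorem t2Space_total [T2Space X] (hX : IsLocallyTrivial X) : T2Space (Quiver.Total X) := by
  refine ⟨fun γ γ' hne => ?_⟩
  have hr := IsTopologicalGroupoid.continuous_range (X := X)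
  by_cases h : γ.right = γ'.right
  · obtain ⟨τ, hτ⟩ := (hX γ.right).2 γ.right
    obtain ⟨e, hτe, he⟩ := (hX γ.right).1 τ
    have := t2Space_rangeFibre (hX γ.right).1
    let V : Set (Quiver.Total X) := (fun γ => γ.right) ⁻¹' e.target
    have hV : IsOpen V := e.open_target.preimage hr
    have hsec : ∀ ζ : V, (e.symm ζ.1.right).1.left = ζ.1.right := fun ζ =>
      (congrFun he _).trans (e.right_inv ζ.2)
    let ψ : V → Quiver.Total X := fun ζ => mul (e.symm ζ.1.right).1 ζ.1 (hsec ζ)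
    have hψc : Continuous ψ := by
      refine (IsTopologicalGroupoid.continuous_mul (X := X)).comp
        (Continuous.subtype_mk (f := fun ζ : V => ((e.symm ζ.1.right).1, ζ.1)) ?_ hsec)
      refine (continuous_subtype_val.comp ?_).prodMk continuous_subtype_val
      exact e.continuousOn_symm.comp_continuous (hr.comp continuous_subtype_val) fun ζ => ζ.2
    have hψr : ∀ ζ, ψ ζ ∈ rangeFibre γ.right := fun ζ => (e.symm ζ.1.right).2
    let Ψ : V → rangeFibre γ.right × X := fun ζ => (⟨ψ ζ, hψr ζ⟩, ζ.1.right)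
    have hΨ : Function.Injective Ψ := by
      intro ζ ζ' hz
      have h1 : ψ ζ = ψ ζ' := congrArg (fun p => p.1.1) hz
      have h2 : ζ.1.right = ζ'.1.right := congrArg Prod.snd hz
      have h3 : ψ ζ = mul (e.symm ζ.1.right).1 ζ'.1 ((hsec ζ).trans h2) := by
        rw [h1]
        simp only [ψ, h2]
      exact Subtype.ext (mul_left_cancel _ _ h3)
    have hVT : T2Space V := T2Space.of_injective_continuous hΨ
      ((hψc.subtype_mk _).prodMk (hr.comp continuous_subtype_val))
    have hγt : γ.right ∈ e.target := by
      have h1 := e.map_source hτe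
      rw [← congrFun he τ] at h1
      rwa [show τ.1.left = γ.right from hτ] at h1
    have hγt' : γ'.right ∈ e.target := by
      rw [← congrArg (· ∈ e.target) h]
      exact hγt
    exact separated_by_isOpenEmbedding hV.isOpenEmbedding_subtypeVal
      (x := ⟨γ, hγt⟩) (y := ⟨γ', hγt'⟩)
      fun hh => hne (congrArg Subtype.val hh)
  · obtain ⟨U, V, hU, hV, hγ, hη, hd⟩ := t2_separation h
    exact ⟨_, _, hU.preimage hr, hV.preimage hr, hγ, hη, hd.preimage _⟩

/-- The isotropy group acts properly discontinuously on the transversal: the arrows `g` with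
`gκ ∈ L` for some `κ ∈ K` lie in the compact set `LK⁻¹` and in a discrete fibre of the source
map. -/
theorem finite_setOf_leftMul_mem [T2Space X] {a : X}
    (hs : IsLocalHomeomorph (fun γ : rangeFibre a => γ.1.left)) {K L : Set (rangeFibre a)}
    (hK : IsCompact K) (hL : IsCompact L) : {g : a ⟶ a | ∃ κ ∈ K, leftMul g κ ∈ L}.Finite := by
  have hC := isCompact_setOf_mul (hL.image continuous_subtype_val)
    ((hK.image continuous_subtype_val).image (IsTopologicalGroupoid.continuous_inv (X := X)))
  have hC' := (isClosed_rangeFibre a).isClosedEmbedding_subtypeVal.isCompact_preimage hC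
  set F : Set (rangeFibre a) := (fun γ : rangeFibre a => γ.1.left) ⁻¹' {a}
  have hFc : IsClosed F := isClosed_singleton.preimage (continuous_source_rangeFibre a)
  have hFd : IsDiscrete F := by
    refine ⟨discreteTopology_subtype_iff'.2 fun γ hγ => ?_⟩
    obtain ⟨e, hγe, he⟩ := hs γ
    refine ⟨e.source, e.open_source, ?_⟩
    ext η
    constructor
    · rintro ⟨h1, h2⟩
      refine e.injOn h1 hγe ?_
      rw [← he]
      exact Eq.trans h2 (Eq.symm hγ)
    · rintro rfl
      exact ⟨hγe, hγ⟩
  have hfin := (hC'.inter_left hFc).finite (hFd.mono Set.inter_subset_left)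
  refine (hfin.preimage (ofHom_injective (a := a) (c := a)).injOn).subset ?_
  rintro g ⟨κ, hκ, hgκ⟩
  refine ⟨rfl, _, ⟨_, hgκ, rfl⟩, _, ⟨_, ⟨κ, hκ, rfl⟩, rfl⟩, rfl, ?_⟩
  obtain ⟨h, hη⟩ := exists_eq_ofHom κ
  rw [hη]
  simp [ofHom, leftMul, mul, inv]

end

theorem locallyCompactSpace_rangeFibre [hG : IsLocallyCompactGroupoid X] (a : X) :
    LocallyCompactSpace (rangeFibre a) := by
  have := hG.locallyCompact_arrows
  have := hG.t2_units
  exact (isClosed_rangeFibre a).isClosedEmbedding_subtypeVal.locallyCompactSpace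

end Topology

universe v u
variable {X : Type u} [Groupoid.{v} X] [TopologicalSpace X] [TopologicalSpace (Quiver.Total X)]

theorem isOpenQuotientMap_source [IsTopologicalGroupoid X] (hX : IsLocallyTrivial X) (x : X) :
    IsOpenQuotientMap (fun γ : rangeFibre x => γ.1.left) :=
  ⟨(hX x).2, continuous_source_rangeFibre x, (hX x).1.isOpenMap⟩

theorem locallyCompactSpace_units [hG : IsLocallyCompactGroupoid X] (hX : IsLocallyTrivial X)
    (x : X) : LocallyCompactSpace X :=
  have := locallyCompactSpace_rangeFibre x
  (isOpenQuotientMap_source hX x).locallyCompactSpace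

/-! ### Haar systems and invariant measures on a transversal -/

section Haar

variable [MeasurableSpace (Quiver.Total X)] [BorelSpace (Quiver.Total X)]

theorem comap_map_leftDiv [IsTopologicalGroupoid X] [T2Space X] {a c : X} (h : c ⟶ a)
    (lam : Measure (rangeFibre a)) :
    (lam.map (leftDiv (ofHom h))).comap (Subtype.val : rangeFibre c → Quiver.Total X) =
      lam.map (leftMul (Groupoid.inv h)) := by
  have hme := (isClosed_rangeFibre c).isClosedEmbedding_subtypeVal.measurableEmbedding
  rw [show leftDiv (ofHom h) = Subtype.val ∘ leftMul (Groupoid.inv h) from rfl,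
    ← Measure.map_map hme.measurable (continuous_leftMul _).measurable, hme.comap_map]

/-- By invariance of `lam`, the image of `lam` under `η ↦ γ⁻¹η` depends only on the source of
`γ`. -/
theorem map_leftDiv_eq [IsTopologicalGroupoid X] {a : X} {lam : Measure (rangeFibre a)}
    (hlam : IsIsotropyInvariant a lam) {γ γ' : rangeFibre a} (h : γ.1.left = γ'.1.left) :
    lam.map (leftDiv γ) = lam.map (leftDiv γ') := by
  obtain ⟨g, rfl⟩ := exists_leftMul_eq h
  have hc : Continuous (leftDiv (leftMul g γ)) :=
    (continuous_leftDiv a).comp (continuous_const.prodMk continuous_id)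
  have : leftDiv γ = leftDiv (leftMul g γ) ∘ leftMul g :=
    funext fun η => (leftDiv_leftMul g γ η).symm
  rw [this, ← Measure.map_map hc.measurable (continuous_leftMul g).measurable, (hlam g).map_eq]

theorem hasSupport_map_leftDiv [IsTopologicalGroupoid X] [T2Space X] {a : X}
    {lam : Measure (rangeFibre a)} (hlam : IsFullRadon lam) (γ : rangeFibre a) :
    HasSupport (lam.map (leftDiv γ)) (rangeFibre γ.1.left) := by
  have hcl := isClosedEmbedding_leftDiv γ
  refine ⟨⟨isClosed_rangeFibre _, ?_⟩, fun C hC => ?_⟩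
  · rw [hcl.measurableEmbedding.map_apply, ← range_leftDiv γ, Set.preimage_compl,
      Set.preimage_range, Set.compl_univ, measure_empty]
  · have h0 := hC.2
    rw [hcl.measurableEmbedding.map_apply, Set.preimage_compl] at h0
    have := hlam.fullSupport.2 ⟨hC.1.preimage hcl.continuous, h0⟩
    rw [← range_leftDiv γ]
    rintro _ ⟨η, rfl⟩
    exact this (Set.mem_univ η)

/-- For `γ` in a compact set `N`, the functions `η ↦ f(γ⁻¹η)` have support in the compact set
`N · supp f`. -/
theorem continuous_integral_leftDiv [IsLocallyCompactGroupoid X] {a : X}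
    (lam : Measure (rangeFibre a)) [IsFiniteMeasureOnCompacts lam] {f : Quiver.Total X → ℂ}
    (hf : Continuous f) (hfc : HasCompactSupport f) :
    Continuous (fun γ => ∫ η, f (leftDiv γ η) ∂lam) := by
  have := locallyCompactSpace_rangeFibre a
  have : T2Space X := IsLocallyCompactGroupoid.t2_units
  refine continuous_iff_continuousAt.2 fun γ₀ => ?_
  obtain ⟨N, hN, hγ₀⟩ := exists_compact_mem_nhds γ₀
  have hC := (isClosed_rangeFibre a).isClosedEmbedding_subtypeVal.isCompact_preimage
    (isCompact_setOf_mul (hN.image continuous_subtype_val) hfc)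
  refine ContinuousOn.continuousAt (s := N) ?_ hγ₀
  refine continuousOn_integral_of_compact_support hC
    (hf.comp (continuous_leftDiv a)).continuousOn fun γ η hγ hη => ?_
  refine image_eq_zero_of_notMem_tsupport fun h => hη ?_
  refine ⟨γ.1, ⟨γ, hγ, rfl⟩, leftDiv γ η, h, rfl, ?_⟩
  obtain ⟨h, hγ⟩ := exists_eq_ofHom γ
  rw [hγ]
  change η.1 = (leftMul h (leftMul (Groupoid.inv h) η)).1
  rw [leftMul_comp, Groupoid.inv_comp, leftMul_id]

/-- An invariant measure on a transversal spreads to a Haar system: `α^u` is the image of `lam`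
under `η ↦ γ⁻¹η` for any `γ` in the transversal with source `u`. -/
theorem exists_isHaarSystem [IsLocallyCompactGroupoid X] (hX : IsLocallyTrivial X) {x : X}
    {lam : Measure (rangeFibre x)} (hlam : IsFullRadon lam) (hinv : IsIsotropyInvariant x lam) :
    ∃ α : X → Measure (Quiver.Total X), IsHaarSystem α := by
  have : T2Space X := IsLocallyCompactGroupoid.t2_units
  have := hlam.regular
  choose σ hσ using (hX x).2
  have hσ' : ∀ u, (σ u).1.left = u := hσ
  let α : X → Measure (Quiver.Total X) := fun u => lam.map (leftDiv (σ u))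
  have hα : ∀ γ : rangeFibre x, α γ.1.left = lam.map (leftDiv γ) := fun γ =>
    map_leftDiv_eq hinv (hσ' _)
  have hint : ∀ (f : Quiver.Total X → ℂ) (γ : rangeFibre x),
      ∫ η, f η ∂(α γ.1.left) = ∫ η, f (leftDiv γ η) ∂lam := fun f γ => by
    rw [hα, (isClosedEmbedding_leftDiv γ).measurableEmbedding.integral_map]
  have hsupp : ∀ u, HasSupport (α u) (rangeFibre u) := fun u => by
    have := hasSupport_map_leftDiv hlam (σ u)
    rwa [hσ' u] at this
  refine ⟨α, ⟨fun u => ?_, hsupp, ?_, ?_⟩, ?_⟩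
  · exact regular_map_of_isClosedEmbedding (isClosedEmbedding_leftDiv (σ u)) lam
  · intro f hf hfc
    refine (isOpenQuotientMap_source hX x).isQuotientMap.continuous_iff.2 ?_
    convert continuous_integral_leftDiv lam hf hfc using 1
    exact funext fun γ => hint f γ
  · intro f hf hfc
    refine HasCompactSupport.intro
      (hfc.isCompact.image (IsTopologicalGroupoid.continuous_range (X := X))) fun u hu => ?_
    refine integral_eq_zero_of_ae ?_
    filter_upwards [compl_mem_ae_iff.2 (hsupp u).1.2] with γ hγ
    rw [compl_compl] at hγ
    exact image_eq_zero_of_notMem_tsupport fun h => hu ⟨γ, h, hγ⟩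
  · intro a b g f hf hfc
    obtain ⟨γ, hγ⟩ := (hX x).2 a
    obtain ⟨h, -⟩ := exists_eq_ofHom γ
    replace h : a ⟶ x := eqToHom hγ.symm ≫ h
    have ha : α a = lam.map (leftDiv (ofHom h)) := hα (ofHom h)
    -- `hg⁻¹` is an element of the transversal with source `b`.
    have hb := hint f (ofHom (Groupoid.inv g ≫ h))
    change ∫ η, f η ∂(α b) = _ at hb
    rw [hb, ha, comap_map_leftDiv]
    change ∫ η, _ ∂(lam.map (leftMulHomeo (Groupoid.inv h))) = _
    rw [(leftMulHomeo (Groupoid.inv h)).measurableEmbedding.integral_map]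
    refine integral_congr_ae (.of_forall fun η => ?_)
    change f (leftMul g (leftMul (Groupoid.inv h) η)).1 = f (leftDiv (ofHom _) η)
    rw [leftDiv_ofHom, leftMul_comp]
    congr 3
    simp

/-- A Haar system restricts to an invariant measure on each transversal. -/
theorem IsHaarSystem.exists_isIsotropyInvariant [hG : IsLocallyCompactGroupoid X]
    (hX : IsLocallyTrivial X) {α : X → Measure (Quiver.Total X)} (hα : IsHaarSystem α) (x : X) :
    ∃ lam : Measure (rangeFibre x), IsFullRadon lam ∧ IsIsotropyInvariant x lam := by
  have := hG.locallyCompact_arrows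
  have : T2Space X := hG.t2_units
  have : T2Space (Quiver.Total X) := t2Space_total hX
  have := hα.regular x
  have hcl := (isClosed_rangeFibre x).isClosedEmbedding_subtypeVal
  have hsupp : HasSupport (α x) (rangeFibre x) := hα.hasSupport x
  set lam : Measure (rangeFibre x) := (α x).comap Subtype.val with hlam
  have hmap : lam.map Subtype.val = α x := by
    rw [hlam, hcl.measurableEmbedding.map_comap, Subtype.range_coe]
    exact Measure.restrict_eq_self_of_ae_mem (compl_mem_ae_iff.1 (by
      simpa [ae_iff, mem_ae_iff] using hsupp.1.2))
  have hreg : lam.Regular := regular_comap_of_isClosedEmbedding hcl (α x) (by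
    rw [Subtype.range_coe]; exact hsupp.1.2)
  refine ⟨lam, ⟨hreg, ⟨isClosed_univ, by simp⟩, fun C hC η _ => ?_⟩, fun g => ?_⟩
  · obtain ⟨D, hD, rfl⟩ := isClosed_induced_iff.1 hC.1
    refine hsupp.2 ⟨hD, ?_⟩ η.2
    rw [← hmap, hcl.measurableEmbedding.map_apply]
    exact hC.2
  · have hg : Measurable (leftMul g) := (continuous_leftMul g).measurable
    refine ⟨hg, ?_⟩
    have hcl' : IsClosedEmbedding (Subtype.val ∘ leftMulHomeo g : rangeFibre x → Quiver.Total X) :=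
      hcl.comp (leftMulHomeo g).isClosedEmbedding
    have hreg' := regular_map_of_isClosedEmbedding hcl' lam
    have key : lam.map (Subtype.val ∘ leftMulHomeo g) = α x := by
      -- Comparing measures on all arrows avoids extending test functions from `G^x`.
      refine Measure.ext_of_integral_eq_on_compactlySupported fun f => ?_
      have hfc : HasCompactSupport (fun γ => (f γ : ℂ)) :=
        f.hasCompactSupport.comp_left (g := ((↑) : ℝ → ℂ)) Complex.ofReal_zero
      have h1 := hα.leftInvariant x x g (fun γ => (f γ : ℂ))
        (Complex.continuous_ofReal.comp f.continuous) hfc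
      rw [integral_complex_ofReal, integral_complex_ofReal] at h1
      rw [hcl'.measurableEmbedding.integral_map]
      exact Complex.ofReal_injective h1
    have h2 := congrArg (Measure.comap (Subtype.val : rangeFibre x → Quiver.Total X)) key
    rwa [← Measure.map_map hcl.continuous.measurable (leftMulHomeo g).continuous.measurable,
      hcl.measurableEmbedding.comap_map] at h2

end Haar

/-! ### Measures on the unit space and on a transversal -/

section Units

/-- The sum of `f` over an orbit of the isotropy group is locally a finite sum. -/
theorem continuous_finsum_leftMul [IsLocallyCompactGroupoid X] (hX : IsLocallyTrivial X) {x : X}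
    (f : CompactlySupportedContinuousMap (rangeFibre x) ℝ) :
    Continuous (fun γ => ∑ᶠ g : x ⟶ x, f (leftMul g γ)) := by
  have := locallyCompactSpace_rangeFibre x
  have : T2Space X := IsLocallyCompactGroupoid.t2_units
  refine continuous_finsum (fun g => f.continuous.comp (continuous_leftMul g)) fun γ₀ => ?_
  obtain ⟨N, hN, hγ₀⟩ := exists_compact_mem_nhds γ₀
  refine ⟨N, hγ₀, (finite_setOf_leftMul_mem (hX x).1 hN f.hasCompactSupport).subset ?_⟩
  rintro g ⟨γ, hγ, hγN⟩
  exact ⟨γ, hγN, subset_tsupport _ hγ⟩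

theorem finite_support_leftMul [IsLocallyCompactGroupoid X] (hX : IsLocallyTrivial X) {x : X}
    (f : CompactlySupportedContinuousMap (rangeFibre x) ℝ) (γ : rangeFibre x) :
    (Function.support fun g : x ⟶ x => f (leftMul g γ)).Finite := by
  have : T2Space X := IsLocallyCompactGroupoid.t2_units
  exact (finite_setOf_leftMul_mem (hX x).1 (isCompact_singleton (x := γ))
    f.hasCompactSupport).subset fun g hg => ⟨γ, rfl, subset_tsupport _ hg⟩

theorem finsum_leftMul_leftMul {X : Type u} [Groupoid.{v} X] {x : X}
    (f : rangeFibre x → ℝ) (k : x ⟶ x) (γ : rangeFibre x) :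
    ∑ᶠ g : x ⟶ x, f (leftMul g (leftMul k γ)) = ∑ᶠ g : x ⟶ x, f (leftMul g γ) := by
  simp only [leftMul_comp]
  exact finsum_comp_equiv (f := fun g => f (leftMul g γ))
    (⟨fun g => k ≫ g, fun g => Groupoid.inv k ≫ g, fun g => by simp, fun g => by simp⟩ :
      (x ⟶ x) ≃ (x ⟶ x))

/-- A fully supported Radon measure on the unit space lifts to a transversal: sum a function over
the fibres of the source map, which are the orbits of the isotropy group, and integrate. -/
theorem exists_isIsotropyInvariant_of_units [MeasurableSpace X] [BorelSpace X]
    [MeasurableSpace (Quiver.Total X)] [BorelSpace (Quiver.Total X)]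
    [IsLocallyCompactGroupoid X] (hX : IsLocallyTrivial X) (x : X) {ν : Measure X}
    (hν : IsFullRadon ν) :
    ∃ lam : Measure (rangeFibre x), IsFullRadon lam ∧ IsIsotropyInvariant x lam := by
  have := locallyCompactSpace_rangeFibre x
  have : T2Space X := IsLocallyCompactGroupoid.t2_units
  have : T2Space (rangeFibre x) := t2Space_rangeFibre (hX x).1
  choose σ hσ using (hX x).2
  have hσ' : ∀ u, (σ u).1.left = u := hσ
  let S : (rangeFibre x → ℝ) → X → ℝ := fun f u => ∑ᶠ g : x ⟶ x, f (leftMul g (σ u))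
  have hS : ∀ (f : rangeFibre x → ℝ) (γ : rangeFibre x),
      S f γ.1.left = ∑ᶠ g : x ⟶ x, f (leftMul g γ) := fun f γ => by
    obtain ⟨k, hk⟩ := exists_leftMul_eq (hσ' γ.1.left).symm
    simp only [S]
    rw [← hk, finsum_leftMul_leftMul]
  let T : CompactlySupportedContinuousMap (rangeFibre x) ℝ →ₗ[ℝ]
      CompactlySupportedContinuousMap X ℝ :=
    { toFun := fun f =>
        { toFun := S f
          continuous_toFun := by
            refine (isOpenQuotientMap_source hX x).isQuotientMap.continuous_iff.2 ?_
            convert continuous_finsum_leftMul hX f using 1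
            exact funext fun γ => hS f γ
          hasCompactSupport' := by
            refine HasCompactSupport.intro
              (f.hasCompactSupport.isCompact.image (continuous_source_rangeFibre x)) fun u hu => ?_
            refine finsum_eq_zero_of_forall_eq_zero fun g => ?_
            exact image_eq_zero_of_notMem_tsupport fun h => hu ⟨_, h, hσ' u⟩ }
      map_add' := fun f g => CompactlySupportedContinuousMap.ext fun u =>
        finsum_add_distrib (finite_support_leftMul hX f _) (finite_support_leftMul hX g _)
      map_smul' := fun c f => CompactlySupportedContinuousMap.ext fun u =>
        (smul_finsum c _).symm }
  obtain ⟨lam, hlam, hint⟩ := exists_isFullRadon_of_transfer hν T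
    (fun f hf u => finsum_nonneg fun g => hf _)
    (fun f hf γ hγ => ⟨γ.1.left, by
      change 0 < S f γ.1.left
      rw [hS]
      refine finsum_pos (fun g => hf _) ⟨𝟙 x, ?_⟩ (finite_support_leftMul hX f γ)
      rwa [leftMul_id]⟩)
  refine ⟨lam, hlam, fun g => ⟨(continuous_leftMul g).measurable, ?_⟩⟩
  have := hlam.regular
  change lam.map (leftMulHomeo g) = lam
  have := Measure.Regular.map (μ := lam) (leftMulHomeo g)
  refine Measure.ext_of_integral_eq_on_compactlySupported fun f => ?_
  rw [(leftMulHomeo g).measurableEmbedding.integral_map, hint]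
  let F : CompactlySupportedContinuousMap (rangeFibre x) ℝ :=
    ⟨⟨fun γ => f (leftMulHomeo g γ), f.continuous.comp (leftMulHomeo g).continuous⟩,
      f.hasCompactSupport.comp_homeomorph (leftMulHomeo g)⟩
  change ∫ γ, F γ ∂lam = _
  rw [hint]
  refine integral_congr_ae (.of_forall fun u => ?_)
  change ∑ᶠ k : x ⟶ x, f (leftMul g (leftMul k (σ u))) = ∑ᶠ k : x ⟶ x, f (leftMul k (σ u))
  simp only [leftMul_comp]
  exact finsum_comp_equiv (f := fun k => f (leftMul k (σ u)))
    (⟨fun k => k ≫ g, fun k => k ≫ Groupoid.inv g, fun k => by simp, fun k => by simp⟩ :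
      (x ⟶ x) ≃ (x ⟶ x))

/-- An open quotient map from a locally compact Hausdorff space onto a paracompact Hausdorff space
admits a Bruhat function: a nonnegative continuous function `w` which does not vanish identically
on any fibre and whose support meets the preimage of a compact set in a relatively compact set. -/
theorem exists_bruhat_function {Y Z : Type*} [TopologicalSpace Y] [T2Space Y]
    [LocallyCompactSpace Y] [TopologicalSpace Z] [T2Space Z] [ParacompactSpace Z] {p : Y → Z}
    (hp : IsOpenQuotientMap p) :
    ∃ w : Y → ℝ, Continuous w ∧ (∀ y, 0 ≤ w y) ∧ (∀ z, ∃ y, p y = z ∧ 0 < w y) ∧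
      ∀ K : Set Z, IsCompact K → ∃ L : Set Y, IsCompact L ∧ ∀ y, p y ∈ K → w y ≠ 0 → y ∈ L := by
  have hb : ∀ y : Y, ∃ f : C(Y, ℝ), f y = 1 ∧ HasCompactSupport f ∧ ∀ z, 0 ≤ f z := fun y => by
    obtain ⟨f, hf1, hfc, -, hf01⟩ := exists_continuousMap_one_of_isCompact_subset_isOpen
      (isCompact_singleton (x := y)) isOpen_univ (Set.subset_univ _)
    exact ⟨f, hf1 rfl, hfc, fun z => (hf01 z).1⟩
  choose f hf1 hfc hf0 using hb
  -- The weight is `w = ∑ i, (φ i ∘ p) * f i`, where `f i > 0` somewhere on each fibre over the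
  -- support of `φ i`.
  obtain ⟨φ, hφ⟩ := PartitionOfUnity.exists_isSubordinate isClosed_univ
    (fun i : Y => p '' {y | 0 < f i y})
    (fun i => hp.isOpenMap _ (isOpen_lt continuous_const (f i).continuous))
    (fun z _ => by
      obtain ⟨y, rfl⟩ := hp.surjective z
      exact Set.mem_iUnion.2 ⟨y, y, by simp [hf1], rfl⟩)
  have hlf : LocallyFinite fun i => Function.support fun y => φ i (p y) * f i y :=
    (φ.locallyFinite.preimage_continuous hp.continuous).subset fun i y hy =>
      left_ne_zero_of_mul hy
  have hnn : ∀ i y, 0 ≤ φ i (p y) * f i y := fun i y => mul_nonneg (φ.nonneg _ _) (hf0 _ _)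
  refine ⟨fun y => ∑ᶠ i, φ i (p y) * f i y, ?_, fun y => finsum_nonneg fun i => hnn i y, ?_, ?_⟩
  · exact continuous_finsum
      (fun i => ((φ i).continuous.comp hp.continuous).mul (f i).continuous) hlf
  · intro z
    obtain ⟨i, hi⟩ := φ.exists_pos (Set.mem_univ z)
    obtain ⟨y, hy, rfl⟩ := hφ i (subset_tsupport _ hi.ne')
    exact ⟨y, rfl, finsum_pos (fun i => hnn i y) ⟨i, mul_pos hi hy⟩ (hlf.point_finite y)⟩
  · intro K hK
    have hfin := φ.locallyFinite.finite_nonempty_inter_compact hK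
    refine ⟨⋃ i ∈ hfin.toFinset, tsupport (f i),
      hfin.toFinset.isCompact_biUnion fun i _ => hfc i, fun y hy hw => ?_⟩
    obtain ⟨i, hi⟩ : ∃ i, φ i (p y) * f i y ≠ 0 := by
      by_contra! h
      exact hw (finsum_eq_zero_of_forall_eq_zero h)
    refine Set.mem_iUnion₂.2 ⟨i, hfin.mem_toFinset.2 ⟨p y, left_ne_zero_of_mul hi, hy⟩, ?_⟩
    exact subset_tsupport _ (right_ne_zero_of_mul hi)

/-- Fully supported Radon measures descend along open quotient maps onto paracompact spaces: weight
them with a Bruhat function. -/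
theorem exists_isFullRadon_of_isOpenQuotientMap {Y Z : Type*} [TopologicalSpace Y] [T2Space Y]
    [LocallyCompactSpace Y] [MeasurableSpace Y] [BorelSpace Y] [TopologicalSpace Z] [T2Space Z]
    [LocallyCompactSpace Z] [ParacompactSpace Z] [MeasurableSpace Z] [BorelSpace Z] {p : Y → Z}
    (hp : IsOpenQuotientMap p) {μ : Measure Y} (hμ : IsFullRadon μ) :
    ∃ ν : Measure Z, IsFullRadon ν := by
  obtain ⟨w, hwc, hw0, hwpos, hwK⟩ := exists_bruhat_function hp
  let T : CompactlySupportedContinuousMap Z ℝ →ₗ[ℝ] CompactlySupportedContinuousMap Y ℝ :=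
    { toFun := fun f =>
        { toFun := fun y => w y * f (p y)
          continuous_toFun := hwc.mul (f.continuous.comp hp.continuous)
          hasCompactSupport' := by
            obtain ⟨L, hL, h⟩ := hwK _ f.hasCompactSupport
            refine HasCompactSupport.intro hL fun y hy => ?_
            by_contra hne
            exact hy (h y (subset_tsupport _ (right_ne_zero_of_mul hne))
              (left_ne_zero_of_mul hne)) }
      map_add' := fun f g => CompactlySupportedContinuousMap.ext fun y => mul_add _ _ _
      map_smul' := fun c f => CompactlySupportedContinuousMap.ext fun y => mul_left_comm _ _ _ }
  obtain ⟨ν, hν, -⟩ := exists_isFullRadon_of_transfer hμ T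
    (fun f hf y => mul_nonneg (hw0 _) (hf _))
    (fun f hf z hz => by
      obtain ⟨y, rfl, hy⟩ := hwpos z
      exact ⟨y, mul_pos hy hz⟩)
  exact ⟨ν, hν⟩

end Units

end TopGpd

theorem mainTheorem1 {X : Type*} [CategoryTheory.Groupoid X]
    [TopologicalSpace X] [MeasurableSpace X] [BorelSpace X]
    [TopologicalSpace (Quiver.Total X)] [MeasurableSpace (Quiver.Total X)]
    [BorelSpace (Quiver.Total X)]
    [TopGpd.IsLocallyCompactGroupoid X] (hX : TopGpd.IsLocallyTrivial X) (x : X) :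
    ((∃ α : X → Measure (Quiver.Total X), TopGpd.IsHaarSystem α) ↔
      (∃ lam : Measure (TopGpd.rangeFibre x),
        TopGpd.IsFullRadon lam ∧ TopGpd.IsIsotropyInvariant x lam)) ∧
    ((∃ ν : Measure X, TopGpd.IsFullRadon ν) →
      (∃ lam : Measure (TopGpd.rangeFibre x),
        TopGpd.IsFullRadon lam ∧ TopGpd.IsIsotropyInvariant x lam)) ∧
    (ParacompactSpace X →
      (∃ lam : Measure (TopGpd.rangeFibre x),
        TopGpd.IsFullRadon lam ∧ TopGpd.IsIsotropyInvariant x lam) →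
      (∃ ν : Measure X, TopGpd.IsFullRadon ν)) := by
  have := TopGpd.locallyCompactSpace_rangeFibre x
  have : T2Space X := TopGpd.IsLocallyCompactGroupoid.t2_units
  have := TopGpd.locallyCompactSpace_units hX x
  have := TopGpd.t2Space_rangeFibre (hX x).1
  refine ⟨⟨?_, ?_⟩, ?_, ?_⟩
  · rintro ⟨α, hα⟩
    exact hα.exists_isIsotropyInvariant hX x
  · rintro ⟨lam, hlam, hinv⟩
    exact TopGpd.exists_isHaarSystem hX hlam hinv
  · rintro ⟨ν, hν⟩
    exact TopGpd.exists_isIsotropyInvariant_of_units hX x hν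
  · rintro _ ⟨lam, hlam, -⟩
    exact TopGpd.exists_isFullRadon_of_isOpenQuotientMap
      (TopGpd.isOpenQuotientMap_source hX x) hlam
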